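/- Let $\mathfrak g$ be a finite-dimensional complex semisimple Lie algebra, $\mathfrak h$ a Cartan subalgebra, $\Delta$ the set of roots, $\Delta_+$ a choice of positive roots, and $\mathfrak b=\mathfrak h+\sum_{\varphi\in\Delta_+}\mathbb C e_\varphi$ the corresponding Borel subalgebra. Let $\mathfrak q\neq\mathfrak g$ be a Lie subalgebra of $\mathfrak g$ containing $\mathfrak b$, let $\mathfrak n$ be the nilradical of $\mathfrak q$, let $\mathfrak m\supseteq\mathfrak h$ be the Levi factor of $\mathfrak q$ containing $\mathfrak h$ (so $\mathfrak m$ is a subalgebra and $\mathfrak q=\mathfrak m\oplus\mathfrak n$), and let $\mathfrak t$ be the center of $\mathfrak m$. For $\nu\in\mathfrak t^*$ put $\mathfrak g_\nu=\{z\in\mathfrak g: [x,z]=\nu(x)z\ \text{for all } x\in\mathfrak t\}$, and let $R=\{\nu\in\mathfrak t^*: \nu\neq 0,\ \mathfrak g_\nu\neq 0\}$ be the set of $\mathfrak t$-roots. For subspaces $U,V$ of $\mathfrak g$, $[U,V]$ denotes the linear span of all $[u,v]$ with $u\in U$, $v\in V$. The restriction to $\mathfrak t$ of the Killing form of $\mathfrak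 g$ is nondegenerate; let $(\cdot,\cdot)$ be the bilinear form it induces on $\mathfrak t^*$. Then for all $\mu,\nu\in R$ the number $(\mu,\nu)$ is real, and: 1. If $\mu+\nu\in R$, then $[\mathfrak g_\mu,\mathfrak g_\nu]=\mathfrak g_{\mu+\nu}$. If $\mu-\nu\in R$, then $[\mathfrak g_\mu,\mathfrak g_{-\nu}]=\mathfrak g_{\mu-\nu}$. 2. If $(\mu,\nu)<0$ and $\mu+\nu\neq 0$, then $\mu+\nu\in R$. If $(\mu,\nu)>0$ and $\mu-\nu\neq 0$, then $\mu-\nu\in R$. 3. If $(\mu,\nu)=0$, then $\mu+\nu\in R$ if and only if $\mu-\nu\in R$. -/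

import Mathlib

namespace LeviRoots

noncomputable section

/-- The nilradical of a (finite-dimensional) complex Lie algebra `Q`: the largest ideal of `Q`
which is nilpotent *as a Lie algebra*. (Mathlib's `LieAlgebra.maxNilpotentIdeal` is a different
ideal: it asks that `Q` itself act nilpotently.) -/
def nilradical (Q : Type*) [LieRing Q] [LieAlgebra ℂ Q] : LieIdeal ℂ Q :=
  sSup {I : LieIdeal ℂ Q | LieRing.IsNilpotent I}

section Subalgebras

variable {L : Type*} [LieRing L] [LieAlgebra ℂ L]

/-- The nilradical of a subalgebra `q ⊆ L`, as a subspace of `L`. -/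
def nilradicalOf (q : LieSubalgebra ℂ L) : Submodule ℂ L :=
  (nilradical q).toSubmodule.map q.toSubmodule.subtype

/-- `m` is a Levi factor of (the parabolic subalgebra) `q`: a subalgebra `m ⊆ q` such that `q` is
the vector space direct sum of `m` and of the nilradical of `q`. -/
structure IsLeviFactor (q m : LieSubalgebra ℂ L) : Prop where
  disjoint : Disjoint m.toSubmodule (nilradicalOf q)
  sup_eq : m.toSubmodule ⊔ nilradicalOf q = q.toSubmodule

/-- The center of a subalgebra `m ⊆ L`, as a subalgebra of `L`. -/
def centerOf (m : LieSubalgebra ℂ L) : LieSubalgebra ℂ L :=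
  (LieAlgebra.center ℂ m).toLieSubalgebra.map m.incl

/-- `g_ν = {z ∈ L | [x, z] = ν(x) z for all x ∈ t}` for `ν ∈ t*`. -/
def rootSpace (t : LieSubalgebra ℂ L) (ν : Module.Dual ℂ t) : Submodule ℂ L where
  carrier := {z | ∀ x : t, ⁅(x : L), z⁆ = ν x • z}
  zero_mem' := by simp
  add_mem' := by
    intro a b ha hb x
    rw [lie_add, ha x, hb x, smul_add]
  smul_mem' := by
    intro c a ha x
    rw [lie_smul, ha x, smul_comm]

/-- The set `R` of `t`-roots: the nonzero `ν ∈ t*` with `g_ν ≠ 0`. -/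
def roots (t : LieSubalgebra ℂ L) : Set (Module.Dual ℂ t) :=
  {ν | ν ≠ 0 ∧ rootSpace t ν ≠ ⊥}

/-- `[U, V]`: the linear span of all brackets `[u, v]` with `u ∈ U`, `v ∈ V`. -/
def bracket (U V : Submodule ℂ L) : Submodule ℂ L :=
  Submodule.span ℂ {z | ∃ u ∈ U, ∃ v ∈ V, ⁅u, v⁆ = z}

/-- The restriction to `t` of the Killing form of `L`. -/
def killingOn (t : LieSubalgebra ℂ L) : LinearMap.BilinForm ℂ t :=
  (killingForm ℂ L).restrict t.toSubmodule

open Classical in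
/-- The bilinear form on `V*` induced by a nondegenerate bilinear form `B` on `V`, that is,
`(μ, ν) = B(x_μ, x_ν)` where `B(x_μ, ·) = μ` and `B(x_ν, ·) = ν` (and `0` if `B` is degenerate). -/
def dualForm {V : Type*} [AddCommGroup V] [Module ℂ V] [FiniteDimensional ℂ V]
    (B : LinearMap.BilinForm ℂ V) (μ ν : Module.Dual ℂ V) : ℂ :=
  if hB : B.Nondegenerate then B ((B.toDual hB).symm μ) ((B.toDual hB).symm ν) else 0

/-- The pairing `(μ, ν)` on `t*` induced by the Killing form of `L`. -/
def pairing [FiniteDimensional ℂ L] (t : LieSubalgebra ℂ L) (μ ν : Module.Dual ℂ t) : ℂ :=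
  dualForm (killingOn t) μ ν

end Subalgebras

section Parabolic

variable {L : Type*} [LieRing L] [LieAlgebra ℂ L] [FiniteDimensional ℂ L]
  [LieAlgebra.IsSemisimple ℂ L]

/-- The Borel subalgebra `h + ∑_{φ ∈ Δ₊} ℂ e_φ` (as a subspace of `L`) attached to a Cartan
subalgebra `H` and a system of simple roots `b`, where `Δ₊` is the set of roots that are positive
with respect to `b`. -/
def borel (H : LieSubalgebra ℂ L) [H.IsCartanSubalgebra]
    (b : (LieAlgebra.IsKilling.rootSystem H).Base) : Submodule ℂ L :=
  H.toSubmodule ⊔ ⨆ φ : {φ : H.root // b.IsPos φ},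
    (LieAlgebra.rootSpace H ((φ : H.root) : LieModule.Weight ℂ H L)).toSubmodule

/-- A standard parabolic subalgebra: a Lie subalgebra containing the Borel subalgebra. -/
def IsStandardParabolic (H : LieSubalgebra ℂ L) [H.IsCartanSubalgebra]
    (b : (LieAlgebra.IsKilling.rootSystem H).Base) (q : LieSubalgebra ℂ L) : Prop :=
  borel H b ≤ q.toSubmodule

end Parabolic

end

end LeviRoots

/-! The subalgebra `t` lies in `H` and is the common kernel there of the roots vanishing on it, so
`t`-roots are nonzero restrictions of roots. The sum `sumDualVec` of the `h_α` over the fiber of `μ`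
is killed by every root vanishing on `t`, so it lies in `t`; it represents a multiple of `μ`. This
gives, for every root `β` over `ν`, the formula `card_mul_pairing`: up to a positive factor, `(μ,
ν)` is a positively weighted sum of the integers `⟨β, α^∨⟩` with `α` over `μ`.

Reality follows. If `(μ, ν) > 0`, some `⟨β, α^∨⟩` is positive and `β - α` is a root, which gives
claim 2. Since `(μ + ν, μ + ν) > 0`, one of `μ`, `ν` pairs positively with `μ + ν`, so each root
over `μ + ν` splits as `α + β` (`exists_eq_add`); with `[g_α, g_β] = g_{α+β}` this gives claim 1.
Claim 3 reflects such a sum in `α`. -/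

namespace LeviRoots

open LieAlgebra LieAlgebra.IsKilling LieModule

/-! ### Root strings and weight decompositions. -/

section RootSpaces

variable {K L : Type*} [Field K] [CharZero K] [LieRing L] [LieAlgebra K L]
  [LieAlgebra.IsKilling K L] [FiniteDimensional K L]
  {H : LieSubalgebra K L} [H.IsCartanSubalgebra] [IsTriangularizable K H L]

/-- `[g_α, g_β] = g_{α + β}` when `α` and `α + β` are roots, in the form: every vector of
`g_{α + β}` is a bracket. -/
lemma exists_lie_eq_of_mem_rootSpace_add {α β γ : Weight K H L} (hα : α.IsNonZero)
    (hγ : γ.IsNonZero) (h : (γ : H → K) = α + β) {z : L} (hz : z ∈ LieAlgebra.rootSpace H γ) :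
    ∃ e ∈ LieAlgebra.rootSpace H α, ∃ y ∈ LieAlgebra.rootSpace H β, ⁅e, y⁆ = z := by
  -- In the `sl₂`-triple of `-α` the lowering operator `f` lies in `g_α`. From the top of the
  -- `-α`-chain through `β`, `p` steps reach `β` and one more reaches `γ`.
  obtain ⟨x, hx, x_ne0⟩ := (chainTop (-α) β).exists_ne_zero
  obtain ⟨k, e, f, isSl2, he, hf⟩ := exists_isSl2Triple_of_weight_isNonZero hα.neg
  obtain rfl := isSl2.h_eq_coroot hα.neg he hf
  have hf' : f ∈ LieAlgebra.rootSpace H α := by simpa using hf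
  have prim : isSl2.HasPrimitiveVectorWith x (chainLength (-α) β : K) :=
    have := lie_mem_genWeightSpace_of_mem_genWeightSpace he hx
    ⟨x_ne0, (chainLength_smul _ _ hx).symm,
      by rwa [genWeightSpace_add_chainTop _ _ hα.neg] at this⟩
  set p := chainTopCoeff (-α) β with hp
  -- As `α + β` is a root, the chain extends at least one step past `β`, so `f ^ (p + 1)` does not
  -- kill `x`.
  have hlen : p + 1 ≤ chainLength (-α) β := by
    rw [← chainTopCoeff_add_chainBotCoeff, ← hp]
    have := (rootSpace_zsmul_add_ne_bot_iff α β hα 1).mp (by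
      rw [one_smul, ← h]; exact γ.genWeightSpace_ne_bot)
    have h1 : chainBotCoeff (-α : H → K) β = chainTopCoeff α β := by
      rw [chainBotCoeff_neg]
    rw [Weight.coe_neg, h1]
    lia
  have hne := prim.pow_toEnd_f_ne_zero_of_eq_nat rfl hlen
  have hy := toEnd_pow_apply_mem hf' hx p
  have hw := toEnd_pow_apply_mem hf' hx (p + 1)
  have e1 : p • (α : H → K) + chainTop (-α) β = β := by
    change p • (α : H → K) + (p • (-(α : H → K)) + (β : H → K)) = β
    rw [← add_assoc, ← smul_add]
    simp
  have e2 : (p + 1) • (α : H → K) + chainTop (-α) β = γ := by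
    rw [succ_nsmul', add_assoc, e1, h]
  rw [e1] at hy
  rw [e2] at hw
  obtain ⟨c, hc⟩ := (finrank_eq_one_iff_of_nonzero' ⟨_, hw⟩ (by simpa using hne)).mp
    (finrank_rootSpace_eq_one γ hγ) ⟨z, hz⟩
  refine ⟨f, hf', c • ((toEnd K L L f ^ p : Module.End K L) x), ?_, ?_⟩
  · exact Submodule.smul_mem _ c hy
  · have := congrArg Subtype.val hc
    rw [lie_smul]
    simpa [pow_succ'] using this

omit [CharZero K] [LieAlgebra.IsKilling K L] in
/-- Every element is a sum of weight vectors. -/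
lemma exists_sum_rootSpace (H : LieSubalgebra K L) [H.IsCartanSubalgebra] [IsTriangularizable K H L]
    (z : L) : ∃ w : Weight K H L → L,
      (∀ α : Weight K H L, w α ∈ LieAlgebra.rootSpace H α) ∧ ∑ α : Weight K H L, w α = z := by
  have hz : z ∈ ⨆ α : Weight K H L, (LieAlgebra.rootSpace H α).toSubmodule := by
    have := iSup_genWeightSpace_eq_top' K H L
    rw [← LieSubmodule.iSup_toSubmodule, this]
    exact Submodule.mem_top
  obtain ⟨f, hf, rfl⟩ := (Submodule.mem_iSup_iff_exists_finsupp _ _).mp hz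
  exact ⟨f, hf, (Finsupp.sum_fintype f (fun _ y ↦ y) fun _ ↦ rfl).symm⟩

/-- An eigenvector of `ad x` with `x ∈ H` has components only in the matching root spaces. -/
lemma apply_eq_of_lie_eq_smul {w : Weight K H L → L}
    (hw : ∀ α : Weight K H L, w α ∈ LieAlgebra.rootSpace H α) {x : H} {c : K}
    (h : ⁅(x : L), ∑ α : Weight K H L, w α⁆ = c • ∑ α : Weight K H L, w α) (α : Weight K H L) (hα : w α ≠ 0) :
    α x = c := by
  have hind : iSupIndep fun α : Weight K H L ↦ (LieAlgebra.rootSpace H α).toSubmodule :=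
    LieSubmodule.iSupIndep_toSubmodule.mpr (iSupIndep_genWeightSpace' K H L)
  have key := (iSupIndep_iff_finsetSum_eq_zero_imp_eq_zero _).mp hind Finset.univ
    (fun α ↦ (α x - c) • w α) (fun α _ ↦ Submodule.smul_mem _ _ (hw α)) (by
      simp_rw [sub_smul]
      rw [Finset.sum_sub_distrib, ← Finset.smul_sum, ← h, lie_sum, sub_eq_zero]
      exact Finset.sum_congr rfl fun α _ ↦ (lie_eq_smul_of_mem_rootSpace (hw α) x).symm)
    α (Finset.mem_univ _)
  simpa [hα, sub_eq_zero] using key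

end RootSpaces

/-! ### Killing duals of roots. -/

section DualVectors

variable {L : Type*} [LieRing L] [LieAlgebra ℂ L] [FiniteDimensional ℂ L]
  [LieAlgebra.IsSemisimple ℂ L] {H : LieSubalgebra ℂ L} [H.IsCartanSubalgebra]

/-- The element `h_α` of `H` representing the root `α` through the Killing form. -/
noncomputable def dualVec (α : H.root) : H := (cartanEquivDual H).symm (α : Weight ℂ H L).toLinear

lemma killingForm_dualVec (α : H.root) (y : H) :
    killingForm ℂ L (dualVec α) y = (α : Weight ℂ H L) y := by
  have : cartanEquivDual H (dualVec α) y = (α : Weight ℂ H L) y := by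
    rw [dualVec, LinearEquiv.apply_symm_apply, Weight.toLinear_apply]
  exact this

lemma killingForm_eq_sum (x y : H) :
    killingForm ℂ L x y = ∑ α : H.root, (α : Weight ℂ H L) x * (α : Weight ℂ H L) y := by
  have := LinearMap.congr_fun₂ (restrict_killingForm_eq_sum (K := ℂ) (L := L) (H := H)) x y
  rw [← Finset.sum_coe_sort] at this
  simp only [LinearMap.sum_apply, LinearMap.smulRight_apply, LinearMap.smul_apply, smul_eq_mul]
    at this
  exact this

/-- `h_α` is a positive real multiple of the coroot `α^∨`. -/
lemma exists_pos_dualVec_eq_smul_coroot (α : H.root) :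
    ∃ r : ℝ, 0 < r ∧ dualVec α = (r : ℂ) • coroot (α : Weight ℂ H L) := by
  set P := rootSystem H
  have hα : (α : Weight ℂ H L).IsNonZero := H.isNonZero_coe_root α
  set a := (α : Weight ℂ H L) (dualVec α)
  have ha : a ≠ 0 := root_apply_cartanEquivDual_symm_ne_zero hα
  have hco : coroot (α : Weight ℂ H L) = (2 * a⁻¹) • dualVec α := by
    rw [mul_smul, ofNat_smul_eq_nsmul]; rfl
  -- Both sides are the Killing form of `α^∨` with itself. As `h_α = (a / 2) α^∨`, the factor sought
  -- is `2 / N`.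
  have hN : 4 * a⁻¹ = ((∑ γ : H.root, (P.pairingIn ℤ γ α) ^ 2 : ℤ) : ℂ) := by
    have h1 := killingForm_eq_sum (coroot (α : Weight ℂ H L)) (coroot (α : Weight ℂ H L))
    have h2 : killingForm ℂ L (coroot (α : Weight ℂ H L)) (coroot (α : Weight ℂ H L))
        = 4 * a⁻¹ := by
      conv_lhs => enter [1, 2]; rw [hco]
      rw [show (((2 * a⁻¹) • dualVec α : H) : L) = (2 * a⁻¹) • (dualVec α : L) from rfl, map_smul, LinearMap.smul_apply, killingForm_dualVec,
        root_apply_coroot hα, smul_eq_mul]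
      ring
    rw [← h2, h1, Int.cast_sum]
    refine Finset.sum_congr rfl fun γ _ ↦ ?_
    have : (γ : Weight ℂ H L) (coroot (α : Weight ℂ H L)) = (P.pairingIn ℤ γ α : ℂ) := by
      have := P.algebraMap_pairingIn ℤ γ α
      simpa [P] using this.symm
    rw [this]; push_cast; ring
  set N : ℤ := ∑ γ : H.root, (P.pairingIn ℤ γ α) ^ 2
  have hNpos : 0 < N := by
    have h0 : 0 ≤ N := Finset.sum_nonneg fun _ _ ↦ sq_nonneg _
    refine lt_of_le_of_ne h0 fun h ↦ ?_
    rw [← h] at hN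
    simp [ha] at hN
  refine ⟨2 / N, by positivity, ?_⟩
  rw [hco, smul_smul]
  have : a⁻¹ = (N : ℂ) / 4 := by rw [← hN]; ring
  have hN' : (N : ℂ) ≠ 0 := by exact_mod_cast hNpos.ne'
  rw [this]; push_cast
  field_simp
  norm_num

/-- The positive factor relating `h_α` to the coroot `α^∨`. -/
noncomputable def dualScale (α : H.root) : ℝ := (exists_pos_dualVec_eq_smul_coroot α).choose

lemma dualScale_pos (α : H.root) : 0 < dualScale α :=
  (exists_pos_dualVec_eq_smul_coroot α).choose_spec.1

lemma apply_dualVec (α β : H.root) :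
    (β : Weight ℂ H L) (dualVec α) =
      ((dualScale α * (rootSystem H).pairingIn ℤ β α : ℝ) : ℂ) := by
  have h := (exists_pos_dualVec_eq_smul_coroot α).choose_spec.2
  have := (rootSystem H).algebraMap_pairingIn ℤ β α
  rw [h, ← Weight.toLinear_apply, map_smul]
  simp only [rootSystem_pairing_apply] at this
  rw [Weight.toLinear_apply, ← this]
  simp [dualScale]

lemma apply_dualVec_comm (α β : H.root) :
    (β : Weight ℂ H L) (dualVec α) = (α : Weight ℂ H L) (dualVec β) := by
  rw [← killingForm_dualVec, ← killingForm_dualVec, LieModule.traceForm_comm]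

end DualVectors

section Subalgebras

variable {L : Type*} [LieRing L] [LieAlgebra ℂ L]

lemma killingOn_isSymm (t : LieSubalgebra ℂ L) (x y : t) :
    killingOn t x y = killingOn t y x :=
  LieModule.traceForm_comm ℂ L L (x : L) (y : L)

lemma bracket_rootSpace_le (t : LieSubalgebra ℂ L) (μ ν : Module.Dual ℂ t) :
    bracket (rootSpace t μ) (rootSpace t ν) ≤ rootSpace t (μ + ν) := by
  rw [bracket, Submodule.span_le]
  rintro _ ⟨u, hu, v, hv, rfl⟩ x
  rw [leibniz_lie, hu x, hv x, smul_lie, lie_smul, ← add_smul]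
  rfl

end Subalgebras

/-! ### Fibers of the restriction of roots to `t`. -/

section Restriction

open Module

variable {L : Type*} [LieRing L] [LieAlgebra ℂ L] [FiniteDimensional ℂ L]
  [LieAlgebra.IsSemisimple ℂ L] {H : LieSubalgebra ℂ L} [H.IsCartanSubalgebra]

lemma exists_root_eq_sub {α γ : H.root} (h : 0 < (rootSystem H).pairingIn ℤ γ α) (hne : γ ≠ α) :
    ∃ β : H.root, ∀ x : H,
      (β : Weight ℂ H L) x = (γ : Weight ℂ H L) x - (α : Weight ℂ H L) x := by
  obtain ⟨β, hβ⟩ := (rootSystem H).root_sub_root_mem_of_pairingIn_pos h hne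
  exact ⟨β, fun x ↦ LinearMap.congr_fun hβ x⟩

variable {t : LieSubalgebra ℂ L}

/-- The restriction of a root to a subalgebra `t` of the Cartan subalgebra `H`. -/
noncomputable def restrictRoot (htH : t ≤ H) (α : H.root) : Dual ℂ t :=
  (α : Weight ℂ H L).toLinear ∘ₗ (LieSubalgebra.inclusion htH : t →ₗ[ℂ] H)

variable (htH : t ≤ H)

omit [LieAlgebra.IsSemisimple ℂ L] in
lemma restrictRoot_apply (α : H.root) (x : t) :
    restrictRoot htH α x = (α : Weight ℂ H L) ⟨x, htH x.2⟩ := rfl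

open Classical in
/-- The roots of `H` that restrict to `μ` on `t`. -/
noncomputable def rootsOver (μ : Dual ℂ t) : Finset H.root := {α | restrictRoot htH α = μ}

omit [LieAlgebra.IsSemisimple ℂ L] in
lemma mem_rootsOver {μ : Dual ℂ t} {α : H.root} :
    α ∈ rootsOver htH μ ↔ restrictRoot htH α = μ := by
  simp [rootsOver]

lemma neg_rootsOver {μ : Dual ℂ t} (h : (rootsOver htH μ).Nonempty) :
    (rootsOver htH (-μ)).Nonempty := by
  obtain ⟨α, hα⟩ := h
  rw [mem_rootsOver] at hα
  refine ⟨⟨-(α : Weight ℂ H L), by simpa using (H.isNonZero_coe_root α).neg⟩, ?_⟩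
  rw [mem_rootsOver, ← hα]
  rfl

/-- The sum of the vectors `h_α` over the roots `α` that restrict to `μ`. -/
noncomputable def sumDualVec (μ : Dual ℂ t) : H := ∑ α ∈ rootsOver htH μ, dualVec α

lemma apply_sumDualVec (β : H.root) (μ : Dual ℂ t) :
    (β : Weight ℂ H L) (sumDualVec htH μ) =
      ((∑ α ∈ rootsOver htH μ, dualScale α * (rootSystem H).pairingIn ℤ β α : ℝ) : ℂ) := by
  rw [sumDualVec, ← Weight.toLinear_apply, map_sum, Complex.ofReal_sum]
  exact Finset.sum_congr rfl fun α _ ↦ apply_dualVec α β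

lemma killingForm_sumDualVec (μ : Dual ℂ t) (y : t) :
    killingForm ℂ L (sumDualVec htH μ) y = (rootsOver htH μ).card * μ y := by
  have h1 : ((sumDualVec htH μ : H) : L) = ∑ α ∈ rootsOver htH μ, (dualVec α : L) := by
    rw [sumDualVec]
    exact map_sum H.toSubmodule.subtype _ _
  rw [h1, map_sum, LinearMap.sum_apply, ← nsmul_eq_mul]
  refine Finset.sum_eq_card_nsmul fun α hα ↦ ?_
  rw [← (mem_rootsOver htH).mp hα, restrictRoot_apply, ← killingForm_dualVec]

/-- The roots over `μ` are permuted by the reflections in the roots vanishing on `t`; hence their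
sum is orthogonal to the latter. -/
lemma apply_sumDualVec_eq_zero {φ : H.root} (hφ : restrictRoot htH φ = 0) (μ : Dual ℂ t) :
    (φ : Weight ℂ H L) (sumDualVec htH μ) = 0 := by
  set P := rootSystem H
  have hsum : ∑ α ∈ rootsOver htH μ, P.pairingIn ℤ α φ = 0 := by
    have hneg : ∑ α ∈ rootsOver htH μ, P.pairingIn ℤ α φ
        = ∑ α ∈ rootsOver htH μ, -P.pairingIn ℤ α φ := by
      refine Finset.sum_equiv (P.reflectionPerm φ) (fun α ↦ ?_) fun α _ ↦ ?_
      · have : restrictRoot htH (P.reflectionPerm φ α) = restrictRoot htH α := by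
          ext x
          have h1 := LinearMap.congr_fun (P.reflectionPerm_root φ α) ⟨x, htH x.2⟩
          have h2 : (φ : Weight ℂ H L) ⟨x, htH x.2⟩ = 0 := by
            rw [← restrictRoot_apply htH φ x, hφ]; rfl
          rw [restrictRoot_apply, restrictRoot_apply]
          simp only [P, LinearMap.sub_apply, LinearMap.smul_apply, rootSystem_root_apply,
            Weight.toLinear_apply, h2, smul_zero, sub_zero] at h1
          exact h1.symm
        rw [mem_rootsOver, mem_rootsOver, this]
      · apply FaithfulSMul.algebraMap_injective ℤ ℂ
        rw [map_neg, P.algebraMap_pairingIn, P.algebraMap_pairingIn,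
          ← P.pairing_reflectionPerm, P.pairing_reflectionPerm_self_right, neg_neg]
    rw [Finset.sum_neg_distrib] at hneg
    lia
  rw [sumDualVec, ← Weight.toLinear_apply, map_sum]
  -- Exchanging `φ(h_α)` for `α(h_φ)` makes the scale depend on `φ` alone, so it factors out of the
  -- sum.
  simp_rw [Weight.toLinear_apply, apply_dualVec_comm _ φ, apply_dualVec]
  rw [← Complex.ofReal_sum, ← Finset.mul_sum, ← Int.cast_sum, hsum]
  simp

end Restriction

/-! ### The induced form on `t*` and its signs. -/

section Relative

open Module

variable {L : Type*} [LieRing L] [LieAlgebra ℂ L] [FiniteDimensional ℂ L]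
  [LieAlgebra.IsSemisimple ℂ L] {H : LieSubalgebra ℂ L} [H.IsCartanSubalgebra]
  {t : LieSubalgebra ℂ L} (htH : t ≤ H)

/-- The subalgebra `t` of `H` is cut out by the roots vanishing on it. -/
def IsCutOutByRoots : Prop :=
  ∀ x : H, (∀ α : H.root, restrictRoot htH α = 0 → (α : Weight ℂ H L) x = 0) → (x : L) ∈ t

variable {htH}

namespace IsCutOutByRoots

variable (ht : IsCutOutByRoots htH)
include ht

lemma sumDualVec_mem (μ : Dual ℂ t) : (sumDualVec htH μ : L) ∈ t :=
  ht _ fun _ hα ↦ apply_sumDualVec_eq_zero htH hα μ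

/-- Testing `x` against the fiber sum through each root `α` gives `α(x) = 0`, the fiber being
nonempty; then `x` is Killing-orthogonal to `H`. -/
lemma killingOn_nondegenerate : (killingOn t).Nondegenerate := by
  have key : ∀ x : t, (∀ y : t, killingOn t x y = 0) → x = 0 := by
    intro x hx
    have h1 : ∀ α : H.root, (α : Weight ℂ H L) ⟨x, htH x.2⟩ = 0 := by
      intro α
      have h2 := killingForm_sumDualVec htH (restrictRoot htH α) x
      have h3 : killingForm ℂ L (sumDualVec htH (restrictRoot htH α)) x = 0 := by
        rw [LieModule.traceForm_comm]
        exact hx ⟨_, ht.sumDualVec_mem _⟩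
      rw [h3, eq_comm, mul_eq_zero, Nat.cast_eq_zero, Finset.card_eq_zero] at h2
      rcases h2 with h2 | h2
      · exact absurd ((mem_rootsOver htH).mpr rfl) (h2 ▸ Finset.notMem_empty α)
      · exact h2
    have h4 : (⟨x, htH x.2⟩ : H) = 0 := by
      refine (traceForm_cartan_nondegenerate ℂ L H).1 _ fun y ↦ ?_
      have := killingForm_eq_sum (⟨x, htH x.2⟩ : H) y
      simp only [h1, zero_mul, Finset.sum_const_zero] at this
      exact this
    exact Subtype.ext (congrArg (fun u : H ↦ (u : L)) h4)
  exact ⟨key, fun y hy ↦ key y fun x ↦ by rw [killingOn_isSymm]; exact hy x⟩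

lemma pairing_comm (μ ν : Dual ℂ t) : pairing t μ ν = pairing t ν μ := by
  simp only [pairing, dualForm, dif_pos ht.killingOn_nondegenerate]
  exact killingOn_isSymm t _ _

lemma pairing_eq_apply (μ ν : Dual ℂ t) : pairing t μ ν =
    ν (((killingOn t).toDual ht.killingOn_nondegenerate).symm μ) := by
  rw [pairing_comm ht]
  simp only [pairing, dualForm, dif_pos ht.killingOn_nondegenerate]
  exact LinearMap.BilinForm.apply_toDual_symm_apply _ _

lemma pairing_add_right (μ ν ν' : Dual ℂ t) :
    pairing t μ (ν + ν') = pairing t μ ν + pairing t μ ν' := by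
  simp only [pairing_eq_apply ht, LinearMap.add_apply]

lemma pairing_neg_right (μ ν : Dual ℂ t) : pairing t μ (-ν) = -pairing t μ ν := by
  simp only [pairing_eq_apply ht, LinearMap.neg_apply]

lemma card_mul_pairing_eq_apply (μ ν : Dual ℂ t) :
    (rootsOver htH μ).card * pairing t μ ν = ν ⟨_, ht.sumDualVec_mem μ⟩ := by
  have h : ((rootsOver htH μ).card : ℂ) •
      ((killingOn t).toDual ht.killingOn_nondegenerate).symm μ = ⟨_, ht.sumDualVec_mem μ⟩ := by
    rw [← map_smul, LinearEquiv.symm_apply_eq]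
    ext y
    exact (killingForm_sumDualVec htH μ y).symm
  rw [← h, map_smul, pairing_eq_apply ht, smul_eq_mul]

/-- The fiber sum lies in `t`, where `β` and `ν` agree. The left side does not depend on `β`, so the
sign of `(μ, ν)` constrains every root over `ν`. -/
lemma card_mul_pairing {β : H.root} (μ : Dual ℂ t) {ν : Dual ℂ t} (hβ : β ∈ rootsOver htH ν) :
    (rootsOver htH μ).card * pairing t μ ν =
      ((∑ α ∈ rootsOver htH μ, dualScale α * (rootSystem H).pairingIn ℤ β α : ℝ) : ℂ) := by
  rw [card_mul_pairing_eq_apply ht, ← apply_sumDualVec, ← (mem_rootsOver htH).mp hβ]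
  rfl

lemma card_mul_pairing_re {β : H.root} (μ : Dual ℂ t) {ν : Dual ℂ t} (hβ : β ∈ rootsOver htH ν) :
    (rootsOver htH μ).card * (pairing t μ ν).re =
      ∑ α ∈ rootsOver htH μ, dualScale α * (rootSystem H).pairingIn ℤ β α := by
  have := congrArg Complex.re (card_mul_pairing ht μ hβ)
  rwa [Complex.ofReal_re, ← Complex.ofReal_natCast, Complex.re_ofReal_mul] at this

lemma pairing_im {μ ν : Dual ℂ t} (hμ : (rootsOver htH μ).Nonempty)
    (hν : (rootsOver htH ν).Nonempty) : (pairing t μ ν).im = 0 := by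
  obtain ⟨β, hβ⟩ := hν
  have := congrArg Complex.im (card_mul_pairing ht μ hβ)
  rw [Complex.ofReal_im, ← Complex.ofReal_natCast, Complex.im_ofReal_mul] at this
  exact (mul_eq_zero.mp this).resolve_left (by exact_mod_cast hμ.card_ne_zero)

/-- Up to a positive factor this is the Killing form of `X` with itself, a sum of squares of the
real numbers `γ(X)`; if all vanish, `X` is orthogonal to `t` and `μ = 0`. -/
lemma pairing_self_re_pos {μ : Dual ℂ t} (hμ0 : μ ≠ 0) (hμ : (rootsOver htH μ).Nonempty) :
    0 < (pairing t μ μ).re := by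
  set X := sumDualVec htH μ
  have hcard : ((rootsOver htH μ).card : ℂ) ≠ 0 := by exact_mod_cast hμ.card_ne_zero
  set q : H.root → ℝ := fun γ ↦
    ∑ α ∈ rootsOver htH μ, dualScale α * (rootSystem H).pairingIn ℤ γ α
  have hq : ∀ γ : H.root, (γ : Weight ℂ H L) X = (q γ : ℂ) := fun γ ↦ apply_sumDualVec htH γ μ
  have h1 : (rootsOver htH μ).card * ((rootsOver htH μ).card * pairing t μ μ)
      = ((∑ γ : H.root, q γ * q γ : ℝ) : ℂ) := by
    rw [card_mul_pairing_eq_apply ht,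
      ← killingForm_sumDualVec htH μ ⟨_, ht.sumDualVec_mem μ⟩, killingForm_eq_sum,
      Complex.ofReal_sum]
    refine Finset.sum_congr rfl fun γ _ ↦ ?_
    rw [hq, Complex.ofReal_mul]
  have h2 : (rootsOver htH μ).card * ((rootsOver htH μ).card * (pairing t μ μ).re)
      = ∑ γ : H.root, q γ * q γ := by
    have := congrArg Complex.re h1
    rwa [Complex.ofReal_re, ← Complex.ofReal_natCast, Complex.re_ofReal_mul,
      Complex.re_ofReal_mul] at this
  have h3 : 0 < ∑ γ : H.root, q γ * q γ := by
    refine lt_of_le_of_ne (Finset.sum_nonneg fun γ _ ↦ mul_self_nonneg _) fun h ↦ hμ0 ?_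
    have h4 : ∀ γ, q γ = 0 := fun γ ↦ mul_self_eq_zero.mp
      ((Finset.sum_eq_zero_iff_of_nonneg fun γ _ ↦ mul_self_nonneg (q γ)).mp h.symm γ
        (Finset.mem_univ _))
    ext y
    have h5 := killingForm_sumDualVec htH μ y
    have h6 := killingForm_eq_sum X ⟨y, htH y.2⟩
    simp only [hq, h4, Complex.ofReal_zero, zero_mul, Finset.sum_const_zero] at h6
    rw [h6, eq_comm, mul_eq_zero] at h5
    exact h5.resolve_left hcard
  rw [← h2] at h3
  have hc : (0 : ℝ) ≤ (rootsOver htH μ).card := Nat.cast_nonneg _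
  exact pos_of_mul_pos_right (pos_of_mul_pos_right h3 hc) hc

/-- If `(μ, ν) > 0` and `μ ≠ ν`, every root over `ν` is the sum of a root over `μ` and a root
over `ν - μ`. -/
lemma exists_eq_add_of_pairing_pos {μ ν : Dual ℂ t} (h : 0 < (pairing t μ ν).re) (hne : μ ≠ ν)
    (hμ : (rootsOver htH μ).Nonempty) {γ : H.root} (hγ : γ ∈ rootsOver htH ν) :
    ∃ α ∈ rootsOver htH μ, ∃ β ∈ rootsOver htH (ν - μ),
      ((γ : Weight ℂ H L) : H → ℂ) = (α : Weight ℂ H L) + (β : Weight ℂ H L) := by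
  have hpos : 0 < ∑ α ∈ rootsOver htH μ, dualScale α * (rootSystem H).pairingIn ℤ γ α := by
    rw [← card_mul_pairing_re ht μ hγ]
    exact mul_pos (by exact_mod_cast hμ.card_pos) h
  obtain ⟨α, hα, hα'⟩ := Finset.exists_lt_of_sum_lt (s := rootsOver htH μ) (f := fun _ ↦ (0 : ℝ))
    (by simpa using hpos)
  have hn : 0 < (rootSystem H).pairingIn ℤ γ α := by
    exact_mod_cast pos_of_mul_pos_right hα' (dualScale_pos α).le
  rw [mem_rootsOver] at hγ
  have hα2 := (mem_rootsOver htH).mp hα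
  obtain ⟨β, hβ⟩ := exists_root_eq_sub hn (by rintro rfl; exact hne (hα2 ▸ hγ))
  refine ⟨α, hα, β, ?_, ?_⟩
  · rw [mem_rootsOver, ← hγ, ← hα2]
    ext x
    exact hβ _
  · ext x
    simp [hβ]

lemma rootsOver_sub_nonempty {μ ν : Dual ℂ t} (h : 0 < (pairing t μ ν).re) (hne : μ ≠ ν)
    (hμ : (rootsOver htH μ).Nonempty) (hν : (rootsOver htH ν).Nonempty) :
    (rootsOver htH (ν - μ)).Nonempty := by
  obtain ⟨γ, hγ⟩ := hν
  obtain ⟨_, _, β, hβ, _⟩ := exists_eq_add_of_pairing_pos ht h hne hμ hγ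
  exact ⟨β, hβ⟩

/-- Every root over `μ + ν` is the sum of a root over `μ` and a root over `ν`. -/
lemma exists_eq_add {μ ν : Dual ℂ t} (hμ0 : μ ≠ 0) (hν0 : ν ≠ 0) (hμν : μ + ν ≠ 0)
    (hμ : (rootsOver htH μ).Nonempty) (hν : (rootsOver htH ν).Nonempty)
    {γ : H.root} (hγ : γ ∈ rootsOver htH (μ + ν)) :
    ∃ α ∈ rootsOver htH μ, ∃ β ∈ rootsOver htH ν,
      ((γ : Weight ℂ H L) : H → ℂ) = (α : Weight ℂ H L) + (β : Weight ℂ H L) := by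
  have hpos := pairing_self_re_pos ht hμν ⟨γ, hγ⟩
  rw [pairing_add_right ht, Complex.add_re, pairing_comm ht _ μ, pairing_comm ht _ ν] at hpos
  rcases lt_or_ge 0 (pairing t μ (μ + ν)).re with h | h
  · have := exists_eq_add_of_pairing_pos ht h (by simpa using hν0) hμ hγ
    rwa [add_sub_cancel_left] at this
  · obtain ⟨β, hβ, α, hα, e⟩ := exists_eq_add_of_pairing_pos ht (μ := ν) (by linarith)
      (by simpa using hμ0) hν hγ
    rw [add_sub_cancel_right] at hα
    exact ⟨α, hα, β, hβ, by rw [e, add_comm]⟩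

lemma rootsOver_sub_nonempty_of_pairing_eq_zero {μ ν : Dual ℂ t} (hμ0 : μ ≠ 0) (hν0 : ν ≠ 0)
    (hμν : μ + ν ≠ 0) (hμ : (rootsOver htH μ).Nonempty) (hν : (rootsOver htH ν).Nonempty)
    (h0 : pairing t μ ν = 0) (hadd : (rootsOver htH (μ + ν)).Nonempty) :
    (rootsOver htH (μ - ν)).Nonempty := by
  by_contra hcon
  have hcon' : ¬ (rootsOver htH (ν - μ)).Nonempty := fun h ↦
    hcon (by simpa using neg_rootsOver htH h)
  have hne : μ ≠ ν := by
    rintro rfl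
    simpa [h0] using pairing_self_re_pos ht hμ0 hμ
  obtain ⟨γ, hγ⟩ := hadd
  obtain ⟨α, hα, β, hβ, e⟩ := exists_eq_add ht hμ0 hν0 hμν hμ hν hγ
  have hα2 := (mem_rootsOver htH).mp hα
  have hβ2 := (mem_rootsOver htH).mp hβ
  -- A positive term would make `β - α'` a root over `ν - μ`. The terms sum to zero, so each of them
  -- vanishes.
  have hle : ∀ α' ∈ rootsOver htH μ,
      dualScale α' * ((rootSystem H).pairingIn ℤ β α' : ℝ) ≤ 0 := by
    intro α' hα'
    refine mul_nonpos_of_nonneg_of_nonpos (dualScale_pos α').le ?_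
    by_contra! hlt
    have hα2' := (mem_rootsOver htH).mp hα'
    obtain ⟨δ, hδ⟩ := exists_root_eq_sub (γ := β) (α := α') (by exact_mod_cast hlt)
      (by rintro rfl; exact hne (hα2' ▸ hβ2))
    refine hcon' ⟨δ, ?_⟩
    rw [mem_rootsOver, ← hβ2, ← hα2']
    ext x
    exact hδ _
  have hsum := card_mul_pairing_re ht μ hβ
  rw [h0, Complex.zero_re, mul_zero] at hsum
  have hz := (Finset.sum_eq_zero_iff_of_nonpos hle).mp hsum.symm α hα
  have hβα : (β : Weight ℂ H L) (coroot (α : Weight ℂ H L)) = 0 := by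
    have h1 : (rootSystem H).pairingIn ℤ β α = 0 := by
      exact_mod_cast (mul_eq_zero.mp hz).resolve_left (dualScale_pos α).ne'
    have h2 := (rootSystem H).algebraMap_pairingIn ℤ β α
    rw [h1] at h2
    simpa using h2.symm
  -- Since `⟨β, α^∨⟩ = 0`, reflecting `γ = α + β` in `α` gives `β - α`.
  refine hcon' ⟨(rootSystem H).reflectionPerm α γ, ?_⟩
  rw [mem_rootsOver, ← hβ2, ← hα2]
  ext x
  have h3 := LinearMap.congr_fun ((rootSystem H).reflectionPerm_root α γ) ⟨x, htH x.2⟩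
  have h4 : ∀ y : H, (γ : Weight ℂ H L) y = (α : Weight ℂ H L) y + (β : Weight ℂ H L) y :=
    fun y ↦ congrFun e y
  simp only [LinearMap.sub_apply, LinearMap.smul_apply, rootSystem_root_apply,
    rootSystem_coroot_apply, rootSystem_toLinearMap_apply, Weight.toLinear_apply, h4, hβα,
    root_apply_coroot (H.isNonZero_coe_root α), smul_eq_mul] at h3
  rw [LinearMap.sub_apply, restrictRoot_apply, restrictRoot_apply, restrictRoot_apply, ← h3]
  ring

end IsCutOutByRoots

/-! ### From roots of `H` to `t`-root spaces. -/

lemma mem_rootSpace_of_mem_rootsOver {ν : Dual ℂ t} {α : H.root} (hα : α ∈ rootsOver htH ν)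
    {z : L} (hz : z ∈ LieAlgebra.rootSpace H (α : Weight ℂ H L)) : z ∈ rootSpace t ν := by
  intro x
  rw [← (mem_rootsOver htH).mp hα, restrictRoot_apply]
  exact lie_eq_smul_of_mem_rootSpace hz ⟨x, htH x.2⟩

/-- For `ν ≠ 0`, the space `g_ν` is the sum of the root spaces of the roots over `ν`. -/
lemma rootSpace_le_of_forall_rootsOver (htH : t ≤ H) {ν : Dual ℂ t} (hν : ν ≠ 0)
    {V : Submodule ℂ L}
    (hV : ∀ α ∈ rootsOver htH ν, ∀ z ∈ LieAlgebra.rootSpace H (α : Weight ℂ H L), z ∈ V) :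
    rootSpace t ν ≤ V := by
  intro z hz
  obtain ⟨w, hw, rfl⟩ := exists_sum_rootSpace H z
  refine Submodule.sum_mem _ fun α _ ↦ ?_
  by_cases h0 : w α = 0
  · rw [h0]; exact zero_mem _
  have h1 : ∀ x : t, α ⟨x, htH x.2⟩ = ν x := fun x ↦
    apply_eq_of_lie_eq_smul hw (x := ⟨x, htH x.2⟩) (hz x) α h0
  have h2 : α.IsNonZero := by
    intro h
    refine hν (LinearMap.ext fun x ↦ ?_)
    rw [← h1 x, h.eq]; rfl
  exact hV ⟨α, by simpa using h2⟩ ((mem_rootsOver htH).mpr (LinearMap.ext h1)) _ (hw α)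

lemma mem_roots_iff (htH : t ≤ H) {ν : Dual ℂ t} :
    ν ∈ roots t ↔ ν ≠ 0 ∧ (rootsOver htH ν).Nonempty := by
  refine and_congr_right fun hν ↦ ⟨fun h ↦ ?_, ?_⟩
  · by_contra hcon
    rw [Finset.not_nonempty_iff_eq_empty] at hcon
    exact h (le_bot_iff.mp (rootSpace_le_of_forall_rootsOver htH hν (by simp [hcon])))
  · rintro ⟨α, hα⟩ h
    obtain ⟨z, hz, hz0⟩ := (α : Weight ℂ H L).exists_ne_zero
    have := mem_rootSpace_of_mem_rootsOver hα hz
    rw [h] at this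
    exact hz0 this

namespace IsCutOutByRoots

variable (ht : IsCutOutByRoots htH) {μ ν : Dual ℂ t} (hμ : μ ∈ roots t) (hν : ν ∈ roots t)
include ht hμ hν

lemma bracket_rootSpace (h : μ + ν ∈ roots t) :
    bracket (rootSpace t μ) (rootSpace t ν) = rootSpace t (μ + ν) := by
  refine le_antisymm (bracket_rootSpace_le t μ ν) ?_
  rw [mem_roots_iff htH] at hμ hν h
  refine rootSpace_le_of_forall_rootsOver htH h.1 fun γ hγ z hz ↦ ?_
  obtain ⟨α, hα, β, hβ, e⟩ := ht.exists_eq_add hμ.1 hν.1 h.1 hμ.2 hν.2 hγ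
  obtain ⟨u, hu, v, hv, rfl⟩ := exists_lie_eq_of_mem_rootSpace_add (H.isNonZero_coe_root α)
    (H.isNonZero_coe_root γ) e hz
  exact Submodule.subset_span ⟨u, mem_rootSpace_of_mem_rootsOver hα hu, v,
    mem_rootSpace_of_mem_rootsOver hβ hv, rfl⟩

lemma sub_mem_roots_of_pairing_pos (h : 0 < (pairing t μ ν).re) (hne : μ - ν ≠ 0) :
    μ - ν ∈ roots t := by
  rw [mem_roots_iff htH] at hμ hν ⊢
  rw [ht.pairing_comm] at h
  exact ⟨hne, ht.rootsOver_sub_nonempty h (sub_ne_zero.mp hne).symm hν.2 hμ.2⟩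

lemma sub_mem_roots_of_pairing_eq_zero (h0 : pairing t μ ν = 0) (h : μ + ν ∈ roots t) :
    μ - ν ∈ roots t := by
  rw [mem_roots_iff htH] at hμ hν h ⊢
  refine ⟨fun he ↦ ?_, ht.rootsOver_sub_nonempty_of_pairing_eq_zero hμ.1 hν.1 h.1 hμ.2 hν.2 h0 h.2⟩
  have := ht.pairing_self_re_pos hμ.1 hμ.2
  rw [← sub_eq_zero.mp he] at h0
  simp [h0] at this

end IsCutOutByRoots

lemma neg_mem_roots (htH : t ≤ H) {ν : Dual ℂ t} (hν : ν ∈ roots t) : -ν ∈ roots t := by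
  rw [mem_roots_iff htH] at hν ⊢
  exact ⟨neg_ne_zero.mpr hν.1, neg_rootsOver htH hν.2⟩

end Relative

/-! ### The center of a subalgebra containing `H`. -/

section Center

variable {L : Type*} [LieRing L] [LieAlgebra ℂ L]

lemma mem_centerOf {m : LieSubalgebra ℂ L} {x : L} :
    x ∈ centerOf m ↔ x ∈ m ∧ ∀ y ∈ m, ⁅x, y⁆ = 0 := by
  constructor
  · intro hx
    obtain ⟨z, hz, rfl⟩ := (LieSubalgebra.mem_map _ _ _).mp hx
    refine ⟨z.2, fun y hy ↦ ?_⟩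
    have h1 : ⁅(⟨y, hy⟩ : m), z⁆ = 0 := hz _
    have h2 : ⁅y, (z : L)⁆ = 0 := congrArg Subtype.val h1
    rw [← lie_skew, neg_eq_zero]
    exact h2
  · rintro ⟨hx, h⟩
    refine (LieSubalgebra.mem_map _ _ _).mpr ⟨⟨x, hx⟩, fun y ↦ Subtype.ext ?_, rfl⟩
    change ⁅(y : L), x⁆ = 0
    rw [← lie_skew, h y y.2, neg_zero]

lemma centerOf_le_of_le {H m : LieSubalgebra ℂ L} [H.IsCartanSubalgebra] (hHm : H ≤ m) :
    centerOf m ≤ H := by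
  intro x hx
  suffices x ∈ H.normalizer by rwa [LieSubalgebra.IsCartanSubalgebra.self_normalizing] at this
  refine (H.mem_normalizer_iff x).mpr fun y hy ↦ ?_
  rw [(mem_centerOf.mp hx).2 y (hHm hy)]
  exact H.zero_mem

/-- The center annihilates each `y ∈ m`, so only weights vanishing on the center occur in `y`; these
vanish at `x` too, hence `[x, y] = 0`. -/
lemma isCutOutByRoots_centerOf [FiniteDimensional ℂ L] [LieAlgebra.IsSemisimple ℂ L]
    {H m : LieSubalgebra ℂ L} [H.IsCartanSubalgebra] (hHm : H ≤ m) :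
    IsCutOutByRoots (centerOf_le_of_le hHm) := by
  intro x hx
  refine mem_centerOf.mpr ⟨hHm x.2, fun y hy ↦ ?_⟩
  obtain ⟨w, hw, rfl⟩ := exists_sum_rootSpace H y
  rw [lie_sum]
  refine Finset.sum_eq_zero fun α _ ↦ ?_
  have h1 : ⁅(x : L), w α⁆ = α x • w α := lie_eq_smul_of_mem_rootSpace (hw α) x
  rw [h1]
  by_cases h0 : w α = 0
  · rw [h0, smul_zero]
  by_cases hα : α.IsZero
  · rw [hα.eq, Pi.zero_apply, zero_smul]
  rw [hx ⟨α, by simpa using hα⟩ (LinearMap.ext fun u ↦ ?_), zero_smul]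
  refine apply_eq_of_lie_eq_smul hw (x := ⟨u, centerOf_le_of_le hHm u.2⟩) ?_ α h0
  rw [LinearMap.zero_apply, zero_smul]
  exact (mem_centerOf.mp u.2).2 _ hy

end Center

end LeviRoots

theorem theorem2p3 {L : Type*} [LieRing L] [LieAlgebra ℂ L] [FiniteDimensional ℂ L]
    [LieAlgebra.IsSemisimple ℂ L]
    (H : LieSubalgebra ℂ L) [H.IsCartanSubalgebra]
    (b : (LieAlgebra.IsKilling.rootSystem H).Base)
    (q : LieSubalgebra ℂ L) (hq : LeviRoots.IsStandardParabolic H b q) (hq_ne : q ≠ ⊤)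
    (m : LieSubalgebra ℂ L) (hm : LeviRoots.IsLeviFactor q m) (hHm : H ≤ m)
    (t : LieSubalgebra ℂ L) (ht : t = LeviRoots.centerOf m) :
    (LeviRoots.killingOn t).Nondegenerate ∧
    ∀ μ ∈ LeviRoots.roots t, ∀ ν ∈ LeviRoots.roots t,
      (LeviRoots.pairing t μ ν).im = 0 ∧
      (μ + ν ∈ LeviRoots.roots t →
        LeviRoots.bracket (LeviRoots.rootSpace t μ) (LeviRoots.rootSpace t ν)
          = LeviRoots.rootSpace t (μ + ν)) ∧
      (μ - ν ∈ LeviRoots.roots t →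
        LeviRoots.bracket (LeviRoots.rootSpace t μ) (LeviRoots.rootSpace t (-ν))
          = LeviRoots.rootSpace t (μ - ν)) ∧
      ((LeviRoots.pairing t μ ν).re < 0 → μ + ν ≠ 0 → μ + ν ∈ LeviRoots.roots t) ∧
      (0 < (LeviRoots.pairing t μ ν).re → μ - ν ≠ 0 → μ - ν ∈ LeviRoots.roots t) ∧
      (LeviRoots.pairing t μ ν = 0 →
        (μ + ν ∈ LeviRoots.roots t ↔ μ - ν ∈ LeviRoots.roots t)) := by
  subst ht
  have htH := LeviRoots.centerOf_le_of_le hHm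
  have hcut := LeviRoots.isCutOutByRoots_centerOf (H := H) hHm
  refine ⟨hcut.killingOn_nondegenerate, fun μ hμ ν hν ↦ ?_⟩
  -- Replacing `ν` by `-ν` yields the remaining half of each claim.
  have hν' := LeviRoots.neg_mem_roots htH hν
  refine ⟨hcut.pairing_im ((LeviRoots.mem_roots_iff htH).mp hμ).2
      ((LeviRoots.mem_roots_iff htH).mp hν).2,
    hcut.bracket_rootSpace hμ hν, fun h ↦ ?_, fun h hne ↦ ?_,
    hcut.sub_mem_roots_of_pairing_pos hμ hν,
    fun h0 ↦ ⟨hcut.sub_mem_roots_of_pairing_eq_zero hμ hν h0, fun h ↦ ?_⟩⟩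
  · rw [sub_eq_add_neg] at h ⊢
    exact hcut.bracket_rootSpace hμ hν' h
  · rw [← sub_neg_eq_add] at hne ⊢
    refine hcut.sub_mem_roots_of_pairing_pos hμ hν' ?_ hne
    rw [hcut.pairing_neg_right, Complex.neg_re]
    linarith
  · rw [← sub_neg_eq_add]
    refine hcut.sub_mem_roots_of_pairing_eq_zero hμ hν' ?_ (by rwa [← sub_eq_add_neg])
    rw [hcut.pairing_neg_right, h0, neg_zero]
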